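/- Let $p\in(0,1]$ and $r\in(0,1)$ be fixed and put $\gamma=1-r$. The Markov random graph $\mathcal G_n$ has vertices $v_1,\dots,v_n$; for $j<i$ let $X^i_j$ be the indicator of the edge $(v_j,v_i)$. The families $(X^i_j)_{j<i}$, $i=2,\dots,n$, are independent of each other. For each $i$ the sequence $X^i_1,\dots,X^i_{i-1}$ is a Markov chain with $P(X^i_1=1)=p$ and, for $2\le j+1<i$, $$P(X^i_{j+1}=1\mid X^i_j=0)=P(X^i_j=1),\qquad P(X^i_{j+1}=1\mid X^i_j=1)=r\,P(X^i_j=1).$$ For an independent set $S$ output by an algorithm on a graph $G$, its performance ratio on $G$ is $\alpha(G)/|S|$, where $\alpha(G)$ is the stability number. Let $\rho_{\mathrm{greedy}}$ be the performance ratio on $\mathcal G_n$ of the greedy algorithm that runs through $v_1,\dots,v_n$ in this order and adds a vertex whenever the set stays independent. Let $\rho_{\mathrm{greedy}[\min]}$ be the largest performance ratio on $\mathcal G_n$, over all ways of breaking ties, of the minimum-degree greedy algorithm, which repeatedly picks a vertex of smallest degree in the graph induced by the remaining vertices, adds it to the output, and deletes it and its neighbours. An event holds w.h.p. if its probability tends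 to $1$ as $n\to\infty$. Then: 1. if $p<1$, there is a constant $C>0$ (depending only on $p$ and $r$) such that w.h.p. $\rho_{\mathrm{greedy}}\le C\,n^{1/(1+\gamma)}$; 2. for every $\epsilon>0$, w.h.p. $\rho_{\mathrm{greedy}[\min]}\le 1+\left(\frac1\gamma+\epsilon\right)\log n$. -/

import Mathlib

open MeasureTheory Filter Topology unitInterval

noncomputable section

namespace MarkovGraph

/-- The law of a Bernoulli variable with success probability `q`. -/
def coin (q : I) : PMF Bool :=
  PMF.ofFintype (fun b => ENNReal.ofReal (if b then (q : ℝ) else 1 - q)) (by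
    have h0 : (0 : ℝ) ≤ q := q.2.1
    have h1 : (0 : ℝ) ≤ 1 - q := sub_nonneg.2 q.2.2
    simp [← ENNReal.ofReal_add h0 h1])

/-- The probability, as an element of `[0,1]`, that the last entry of a random Boolean word of
length `k + 1` with law `μ` is `true`. -/
def lastProb {k : ℕ} (μ : PMF (Fin (k + 1) → Bool)) : I :=
  ⟨μ.toMeasure.real {x | x (Fin.last k) = true}, measureReal_nonneg, measureReal_le_one⟩

/-- The joint law of the indicators `(X_1, …, X_k)` of the edges from a vertex `v_i` to the first
`k` vertices (`k < i`). The first indicator is Bernoulli with parameter `p`. Given the values of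
`X_1, …, X_j`, the indicator `X_{j+1}` is Bernoulli with parameter `q` if `X_j = 0` and with
parameter `r * q` if `X_j = 1`, where `q = P(X_j = 1)` is the unconditional probability. -/
def rowLaw (p r : I) : (k : ℕ) → PMF (Fin k → Bool)
  | 0 => PMF.pure Fin.elim0
  | 1 => (coin p).map (fun b _ => b)
  | k + 2 =>
    (rowLaw p r (k + 1)).bind fun x =>
      (coin (if x (Fin.last k) = true then r * lastProb (rowLaw p r (k + 1))
        else lastProb (rowLaw p r (k + 1)))).map
        (fun b => (Fin.snoc x b : Fin (k + 2) → Bool))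

/-- The sample space of the graph on the vertices `0, …, n - 1` (that is, `v_1, …, v_n`): the
value `ω i j` for `j < i` is the indicator of the edge between the vertices `j` and `i`. -/
abbrev Sample (n : ℕ) : Type := ∀ i : Fin n, Fin (i : ℕ) → Bool

/-- The probability measure of the Markov random graph with initial probability `p` and decay
parameter `r`: the families of edges from different vertices to their predecessors are
independent. -/
def graphMeasure (p r : I) (n : ℕ) : Measure (Sample n) :=
  Measure.pi fun i : Fin n => (rowLaw p r (i : ℕ)).toMeasure

/-- The graph determined by a sample. -/
def graph {n : ℕ} (ω : Sample n) : SimpleGraph (Fin n) where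
  Adj u v := (∃ h : (u : ℕ) < v, ω v ⟨u, h⟩ = true) ∨ (∃ h : (v : ℕ) < u, ω u ⟨v, h⟩ = true)
  symm := ⟨fun _ _ h => h.symm⟩
  loopless := ⟨fun v h => by simp at h⟩

/-- A sequence of events (the `n`-th one being a property of graphs on `n` vertices) holds with
high probability in the Markov random graph. -/
def WHP (p r : I) (P : ∀ n : ℕ, SimpleGraph (Fin n) → Prop) : Prop :=
  Tendsto (fun n : ℕ => graphMeasure p r n {ω | P n (graph ω)}) atTop (𝓝 1)

open Classical in
/-- The output of the greedy algorithm that runs through the vertices in their order and adds a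
vertex whenever the set stays independent. -/
def inOrderGreedy {n : ℕ} (G : SimpleGraph (Fin n)) : Finset (Fin n) :=
  (List.finRange n).foldl (fun S v => if ∀ u ∈ S, ¬ G.Adj u v then insert v S else S) ∅

open Classical in
/-- `MinDegreeRun G R S`: started on the subgraph of `G` induced by the set `R` of remaining
vertices, the minimum-degree greedy algorithm can output `S`. At each iteration it picks a vertex
`v` of smallest degree in the graph induced by the remaining vertices (ties are broken in any way),
puts `v` into the output, and deletes `v` and its neighbours. -/
inductive MinDegreeRun {V : Type} [Fintype V] (G : SimpleGraph V) : Finset V → Finset V → Prop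
  | done : MinDegreeRun G ∅ ∅
  | pick {R S : Finset V} (v : V) (hv : v ∈ R)
      (hmin : ∀ u ∈ R, (R.filter fun w => G.Adj v w).card ≤ (R.filter fun w => G.Adj u w).card)
      (hrest : MinDegreeRun G (R.filter fun w => w ≠ v ∧ ¬ G.Adj v w) S) :
      MinDegreeRun G R (insert v S)

/-- `S` is a possible output of the minimum-degree greedy algorithm on `G`. -/
def IsMinDegreeOutput {V : Type} [Fintype V] (G : SimpleGraph V) (S : Finset V) : Prop :=
  MinDegreeRun G Finset.univ S

/-- The minimum-degree greedy algorithm has an output on every graph. -/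
theorem exists_isMinDegreeOutput {V : Type} [Fintype V] (G : SimpleGraph V) :
    ∃ S, IsMinDegreeOutput G S := by
  classical
  suffices h : ∀ R : Finset V, ∃ S, MinDegreeRun G R S from h _
  intro R
  induction R using Finset.strongInduction with
  | H R ih =>
    rcases R.eq_empty_or_nonempty with rfl | hR
    · exact ⟨∅, .done⟩
    · obtain ⟨v, hv, hmin⟩ :=
        Finset.exists_min_image R (fun u => (R.filter fun w => G.Adj u w).card) hR
      obtain ⟨S, hS⟩ := ih (R.filter fun w => w ≠ v ∧ ¬ G.Adj v w)
        (Finset.filter_ssubset.2 ⟨v, hv, by simp⟩)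
      refine ⟨insert v S, .pick v hv ?_ ?_⟩
      · intro u hu
        convert hmin u hu
      · convert hS

/-- The performance ratio `α(G) / |S|` on `G` of an algorithm that outputs the set `S`. -/
def performanceRatio {V : Type} [Fintype V] (G : SimpleGraph V) (S : Finset V) : ℝ :=
  (G.indepNum : ℝ) / (S.card : ℝ)

end MarkovGraph

end

/-! Write `γ = 1 - r` and let `q` be the unconditional edge probability along a row. Total
probability gives the logistic recursion `q ↦ q * (1 - γ * q)`, so `q` decays like `1 / (γ * k)`,
its partial sums are at most `log k / γ + O(1)`, and its squares are summable. An earlier edge can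
only lower the chance of the next one (`condProb_le`), so each row can be compared with independent
coins of bias `edgeProb`.

In-order greedy: a new vertex avoids a current set of size `k` with probability at least `∏ (1 -
edgeProb j)` over `j < k`, which is at least `c * k ^ (-1 / γ)` (`exists_mul_rpow_le_prod`). While
the set has fewer than `M` elements, acceptance thus has probability at least `c * M ^ (-1 / γ)`. An
exponential potential shows that size `M` is reached once `n * M ^ (-1 / γ)` is a large enough
multiple of `M`, that is, for `M` of order `n ^ (γ / (1 + γ))`. The trivial bound `α(G) ≤ n`
finishes.

Minimum-degree greedy: a deterministic Turán-type count bounds the ratio by one plus the number of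
edges per vertex (`performanceRatio_le_of_isMinDegreeOutput`). A Chernoff bound
(`graphE_lt_edgeCount_le`) then controls the number of edges, whose mean is at most `n * log n / γ +
O(n)`. -/

namespace MarkovGraph

/-! ### Deterministic edge counting for minimum-degree greedy -/

section MinDegree

variable {V : Type} (G : SimpleGraph V)

open Classical in
/-- The number of ordered pairs in `A ×ˢ B` that are adjacent in `G`. -/
noncomputable def adjPairs (A B : Finset V) : ℝ :=
  ∑ a ∈ A, ∑ b ∈ B, if G.Adj a b then 1 else 0

theorem adjPairs_comm (A B : Finset V) : adjPairs G A B = adjPairs G B A := by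
  classical
  unfold adjPairs
  rw [Finset.sum_comm]
  simp only [G.adj_comm]

theorem adjPairs_union_left [DecidableEq V] {A A' : Finset V} (h : Disjoint A A') (B : Finset V) :
    adjPairs G (A ∪ A') B = adjPairs G A B + adjPairs G A' B :=
  Finset.sum_union h

theorem adjPairs_union_right [DecidableEq V] (A : Finset V) {B B' : Finset V} (h : Disjoint B B') :
    adjPairs G A (B ∪ B') = adjPairs G A B + adjPairs G A B' := by
  rw [adjPairs_comm, adjPairs_union_left G h, adjPairs_comm G B, adjPairs_comm G B']

/-- Among the ordered pairs of distinct vertices of `K`, those inside `T ∩ K` are non-adjacent. This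
saving is what brings the stability number into the edge count. -/
theorem adjPairs_self_le [DecidableEq V] {T : Finset V} (hI : G.IsIndepSet T) (K : Finset V) :
    adjPairs G K K ≤ (K.card : ℝ) ^ 2 - K.card - ((T ∩ K).card : ℝ) ^ 2 + (T ∩ K).card := by
  classical
  have hpt : ∀ a b : V, (if G.Adj a b then (1 : ℝ) else 0) ≤
      1 - (if a = b then 1 else 0) - (if a ∈ T then 1 else 0) * (if b ∈ T then 1 else 0)
        + (if a = b then (if a ∈ T then 1 else 0) else 0) := by
    intro a b
    by_cases hab : a = b
    · subst hab
      by_cases ha : a ∈ T <;> simp [ha]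
    · by_cases ha : a ∈ T
      · by_cases hb : b ∈ T
        · have := hI ha hb hab
          simp [ha, hb, hab, this]
        · simp only [ha, hb, hab, if_false]; split_ifs <;> norm_num
      · simp only [ha, hab, if_false]; split_ifs <;> norm_num
  have hk : ∑ b ∈ K, (if b ∈ T then (1 : ℝ) else 0) = (T ∩ K).card := by
    rw [Finset.sum_boole, Finset.filter_mem_eq_inter, Finset.inter_comm]
  calc adjPairs G K K ≤ ∑ a ∈ K, ∑ b ∈ K, (1 - (if a = b then (1 : ℝ) else 0)
        - (if a ∈ T then 1 else 0) * (if b ∈ T then 1 else 0)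
        + (if a = b then (if a ∈ T then 1 else 0) else 0)) :=
        Finset.sum_le_sum fun a _ => Finset.sum_le_sum fun b _ => hpt a b
    _ = ∑ a ∈ K, ((K.card : ℝ) - 1 - (if a ∈ T then 1 else 0) * ((T ∩ K).card : ℝ)
        + (if a ∈ T then 1 else 0)) := by
        refine Finset.sum_congr rfl fun a ha => ?_
        rw [Finset.sum_add_distrib, Finset.sum_sub_distrib, Finset.sum_sub_distrib,
          ← Finset.mul_sum, hk, Finset.sum_ite_eq, Finset.sum_ite_eq]
        simp [ha]
    _ = _ := by
        rw [Finset.sum_add_distrib, Finset.sum_sub_distrib, ← Finset.sum_mul, hk]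
        simp
        ring

variable [Fintype V]

theorem MinDegreeRun.subset {G : SimpleGraph V} {R S : Finset V} (h : MinDegreeRun G R S) :
    S ⊆ R := by
  classical
  induction h with
  | done => exact subset_rfl
  | pick v hv _ _ ih =>
    intro w hw
    rcases Finset.mem_insert.1 hw with rfl | hw
    · exact hv
    · exact (Finset.mem_filter.1 (ih hw)).1

open Classical in
/-- The edge-counting bound for minimum-degree greedy, linearised in the auxiliary parameters
`x` and `y`. -/
theorem MinDegreeRun.le_adjPairs {G : SimpleGraph V} {R S T : Finset V}
    (hI : G.IsIndepSet T) (x y : ℝ) (h : MinDegreeRun G R S) :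
    2 * x * R.card + 2 * y * (T ∩ R).card - (x ^ 2 + y ^ 2) * S.card - R.card - (T ∩ R).card
      ≤ adjPairs G R R := by
  induction h with
  | done => simp [adjPairs]
  | @pick R S v hv hmin hrest ih =>
    set R' := R.filter fun w => w ≠ v ∧ ¬ G.Adj v w with hR'
    set K := R.filter fun w => ¬ (w ≠ v ∧ ¬ G.Adj v w) with hK
    have hdis : Disjoint K R' := (Finset.disjoint_filter_filter_not _ _ _).symm
    have hun : K ∪ R' = R := by
      rw [Finset.union_comm]; exact Finset.filter_union_filter_not_eq _ _
    have hvS : v ∉ S := fun hvS =>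
      (Finset.mem_filter.1 (hrest.subset hvS)).2.1 rfl
    have hcard : (R.card : ℝ) = K.card + R'.card := by
      rw [← hun, Finset.card_union_of_disjoint hdis]; push_cast; ring
    have hcardI : ((T ∩ R).card : ℝ) = (T ∩ K).card + (T ∩ R').card := by
      rw [← hun, Finset.inter_union_distrib_left, Finset.card_union_of_disjoint]
      · push_cast; ring
      · exact hdis.mono Finset.inter_subset_right Finset.inter_subset_right
    have hKcard : K.card = (R.filter fun w => G.Adj v w).card + 1 := by
      have : K = insert v (R.filter fun w => G.Adj v w) := by
        ext w
        simp only [hK, Finset.mem_filter, Finset.mem_insert]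
        by_cases hw : w = v
        · subst hw; simp [hv]
        · simp [hw]
      rw [this, Finset.card_insert_of_notMem]
      simp
    -- `K` is the closed neighbourhood of `v` in `R`; minimality of `v` gives each of its vertices
    -- degree at least `K.card - 1` in `R`.
    have hdeg : (K.card : ℝ) * (K.card - 1) ≤ adjPairs G K R := by
      have : ∀ a ∈ K, ((K.card : ℝ) - 1) ≤ ∑ b ∈ R, if G.Adj a b then (1 : ℝ) else 0 := by
        intro a ha
        have h1 := hmin a (Finset.mem_filter.1 ha).1
        rw [Finset.sum_boole, hKcard]
        push_cast
        have h2 : ((R.filter fun w => G.Adj v w).card : ℝ) ≤ (R.filter fun w => G.Adj a w).card := by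
          exact_mod_cast h1
        linarith
      calc (K.card : ℝ) * (K.card - 1) = ∑ _a ∈ K, ((K.card : ℝ) - 1) := by
            rw [Finset.sum_const, nsmul_eq_mul]
        _ ≤ _ := Finset.sum_le_sum this
    have hsplit : adjPairs G K R = adjPairs G K K + adjPairs G K R' := by
      conv_lhs => rw [← hun]
      exact adjPairs_union_right G K hdis
    have htot : adjPairs G R R = adjPairs G K K + 2 * adjPairs G K R' + adjPairs G R' R' := by
      conv_lhs => rw [← hun]
      rw [adjPairs_union_left G hdis, adjPairs_union_right G _ hdis, adjPairs_union_right G _ hdis,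
        adjPairs_comm G R' K]
      ring
    have hKK := adjPairs_self_le G hI K
    rw [Finset.card_insert_of_notMem hvS, hcard, hcardI]
    push_cast
    -- With `k = K.card` and `t = (T ∩ K).card`, the pairs lost with `K` number `2 * adjPairs K R -
    -- adjPairs K K ≥ k² - k + t² - t`. The squares are replaced by their tangents: `k² ≥ 2xk - x²`
    -- and `t² ≥ 2yt - y²`.
    nlinarith [sq_nonneg ((K.card : ℝ) - x), sq_nonneg (((T ∩ K).card : ℝ) - y)]

/-- Minimum-degree greedy has performance ratio at most `1 + d / 2`, where `d` is the average
degree. -/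
theorem performanceRatio_le_of_isMinDegreeOutput {G : SimpleGraph V} {S : Finset V}
    (h : IsMinDegreeOutput G S) (hV : 0 < Fintype.card V) :
    performanceRatio G S ≤ 1 + adjPairs G Finset.univ Finset.univ / (2 * Fintype.card V) := by
  classical
  obtain ⟨T, hI⟩ := G.exists_isNIndepSet_indepNum
  have hn : (0 : ℝ) < Fintype.card V := by exact_mod_cast hV
  have hS : (0 : ℝ) < S.card := by
    have : S.Nonempty := by
      obtain ⟨v⟩ := Fintype.card_pos_iff.1 hV
      unfold IsMinDegreeOutput at h
      generalize hR : (Finset.univ : Finset V) = R at h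
      cases h with
      | done => have := Finset.mem_univ v; simp [hR] at this
      | pick v _ _ _ => exact Finset.insert_nonempty _ _
    exact_mod_cast this.card_pos
  have hle : (T.card : ℝ) ≤ Fintype.card V := by exact_mod_cast Finset.card_le_univ T
  -- The optimal tangent points are the averages of `k` and `t` over the `S.card` iterations; this
  -- replaces Cauchy–Schwarz.
  have key := MinDegreeRun.le_adjPairs hI.isIndepSet ((Fintype.card V : ℝ) / S.card)
    ((T.card : ℝ) / S.card) h
  rw [Finset.inter_univ, Finset.card_univ] at key
  unfold performanceRatio
  rw [← hI.card_eq]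
  set n : ℝ := (Fintype.card V : ℝ)
  set a : ℝ := (T.card : ℝ)
  set s : ℝ := (S.card : ℝ)
  have e1 : 2 * (n / s) * n + 2 * (a / s) * a - ((n / s) ^ 2 + (a / s) ^ 2) * s
      = (n ^ 2 + a ^ 2) / s := by
    field_simp
    ring
  have e2 : 2 * n * (a / s) ≤ (n ^ 2 + a ^ 2) / s := by
    rw [mul_div_assoc']
    gcongr
    nlinarith [sq_nonneg (n - a)]
  have e3 : 2 * n * (a / s) ≤ adjPairs G Finset.univ Finset.univ + 2 * n := by linarith
  have e4 : a / s ≤ (adjPairs G Finset.univ Finset.univ + 2 * n) / (2 * n) := by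
    rw [le_div_iff₀ (by positivity)]; linarith
  refine e4.trans_eq ?_
  field_simp
  ring

end MinDegree

theorem performanceRatio_le_card_div {V : Type} [Fintype V] (G : SimpleGraph V) (S : Finset V) :
    performanceRatio G S ≤ Fintype.card V / S.card := by
  unfold performanceRatio
  obtain ⟨T, hI⟩ := G.exists_isNIndepSet_indepNum
  rw [← hI.card_eq]
  gcongr
  exact Finset.card_le_univ T

/-! ### The law of a single row -/

variable (p r : I)

/-- The expectation of `f` under `rowLaw p r k`. -/
noncomputable def rowE (k : ℕ) (f : (Fin k → Bool) → ℝ) : ℝ :=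
  ∑ x, (rowLaw p r k x).toReal * f x

/-- The expectation of `F` under `graphMeasure p r n`. -/
noncomputable def graphE (n : ℕ) (F : Sample n → ℝ) : ℝ :=
  ∑ ω : Sample n, (∏ i : Fin n, (rowLaw p r (i : ℕ) (ω i)).toReal) * F ω

/-- The largest conditional probability, given the past, of the indicator with index `k`. -/
noncomputable def edgeProb : ℕ → ℝ
  | 0 => p
  | k + 1 => lastProb (rowLaw p r (k + 1))

/-- The conditional probability of an edge with index `k` given the indicators `x` before it. -/
noncomputable def condProb : (k : ℕ) → (Fin k → Bool) → I
  | 0, _ => p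
  | k + 1, x => if x (Fin.last k) = true then r * lastProb (rowLaw p r (k + 1))
      else lastProb (rowLaw p r (k + 1))

theorem coe_coin_true (q : I) : (coin q true).toReal = q := by
  simp [coin, q.2.1]

theorem coe_coin_false (q : I) : (coin q false).toReal = 1 - q := by
  simp [coin, sub_nonneg.2 q.2.2]

theorem rowLaw_succ (k : ℕ) : rowLaw p r (k + 1) =
    (rowLaw p r k).bind fun x => (coin (condProb p r k x)).map
      (fun b => (Fin.snoc x b : Fin (k + 1) → Bool)) := by
  cases k with
  | zero =>
    simp only [rowLaw, PMF.pure_bind, condProb]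
    congr 1
  | succ k => rfl

theorem rowLaw_snoc (k : ℕ) (x : Fin k → Bool) (b : Bool) :
    rowLaw p r (k + 1) (Fin.snoc x b) = rowLaw p r k x * coin (condProb p r k x) b := by
  classical
  rw [rowLaw_succ, PMF.bind_apply, tsum_fintype, Finset.sum_eq_single x]
  · congr 1
    rw [PMF.map_apply, tsum_fintype, Finset.sum_eq_single b]
    · simp
    · intro c _ hc
      rw [if_neg]
      intro h
      exact hc (Fin.snoc_inj.1 h).2.symm
    · simp
  · intro y _ hy
    rw [mul_eq_zero]
    right
    rw [PMF.map_apply, tsum_fintype]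
    refine Finset.sum_eq_zero fun c _ => if_neg fun h => hy (Fin.snoc_inj.1 h).1.symm
  · simp

theorem rowE_zero (f : (Fin 0 → Bool) → ℝ) : rowE p r 0 f = f Fin.elim0 := by
  unfold rowE
  rw [Fintype.sum_subsingleton _ Fin.elim0]
  simp [rowLaw]

/-- Conditioning on all indicators but the last; the row estimates are inductions on this identity.
-/
theorem rowE_succ (k : ℕ) (f : (Fin (k + 1) → Bool) → ℝ) :
    rowE p r (k + 1) f = rowE p r k fun x =>
      (1 - condProb p r k x) * f (Fin.snoc x false) + condProb p r k x * f (Fin.snoc x true) := by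
  unfold rowE
  rw [← (Fin.snocEquiv fun _ : Fin (k + 1) => Bool).sum_comp, Fintype.sum_prod_type_right]
  refine Finset.sum_congr rfl fun x _ => ?_
  have h : ∀ b, (Fin.snocEquiv fun _ : Fin (k + 1) => Bool) (b, x)
      = (Fin.snoc x b : Fin (k + 1) → Bool) := fun b => rfl
  simp only [h, Fintype.sum_bool, rowLaw_snoc, ENNReal.toReal_mul, coe_coin_true, coe_coin_false]
  ring

theorem rowE_mono {k : ℕ} {f g : (Fin k → Bool) → ℝ} (h : ∀ x, f x ≤ g x) :
    rowE p r k f ≤ rowE p r k g :=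
  Finset.sum_le_sum fun x _ => mul_le_mul_of_nonneg_left (h x) ENNReal.toReal_nonneg

theorem rowE_const_mul {k : ℕ} (c : ℝ) (f : (Fin k → Bool) → ℝ) :
    rowE p r k (fun x => c * f x) = c * rowE p r k f := by
  unfold rowE
  rw [Finset.mul_sum]
  exact Finset.sum_congr rfl fun x _ => by ring

theorem rowE_mul_const {k : ℕ} (c : ℝ) (f : (Fin k → Bool) → ℝ) :
    rowE p r k (fun x => f x * c) = rowE p r k f * c := by
  simp only [mul_comm _ c, rowE_const_mul]

theorem rowE_add {k : ℕ} (f g : (Fin k → Bool) → ℝ) :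
    rowE p r k (fun x => f x + g x) = rowE p r k f + rowE p r k g := by
  simp only [rowE, mul_add, Finset.sum_add_distrib]

theorem rowE_const (k : ℕ) (c : ℝ) : rowE p r k (fun _ => c) = c := by
  induction k with
  | zero => rw [rowE_zero]
  | succ k ih =>
    rw [rowE_succ, ← ih]
    congr 1
    funext x
    rw [ih]
    ring

theorem toMeasure_real_eq_sum {α : Type*} [Fintype α] [MeasurableSpace α]
    [MeasurableSingletonClass α] (μ : PMF α) (s : Set α) [DecidablePred (· ∈ s)] :
    μ.toMeasure.real s = ∑ x, (μ x).toReal * if x ∈ s then 1 else 0 := by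
  rw [Measure.real, PMF.toMeasure_apply_fintype, ENNReal.toReal_sum]
  · refine Finset.sum_congr rfl fun x _ => ?_
    by_cases hx : x ∈ s <;> simp [hx]
  · intro x _
    by_cases hx : x ∈ s <;> simp [hx, μ.apply_ne_top]

theorem coe_lastProb (k : ℕ) : (lastProb (rowLaw p r (k + 1)) : ℝ)
    = rowE p r (k + 1) fun x => if x (Fin.last k) = true then 1 else 0 := by
  classical
  simp only [lastProb, rowE]
  rw [toMeasure_real_eq_sum]
  rfl

/-- The indices are shifted: `edgeProb 0` and `edgeProb 1` are both `p`, since a second indicator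
following a non-edge has the bias of the first. -/
theorem edgeProb_one : edgeProb p r 1 = p := by
  rw [edgeProb, coe_lastProb, rowE_succ, rowE_zero]
  simp only [Fin.snoc_last, condProb]
  simp

/-- Total probability: `(1 - q) * q + q * (r * q) = q * (1 - (1 - r) * q)`. -/
theorem edgeProb_add_two (k : ℕ) : edgeProb p r (k + 2)
    = edgeProb p r (k + 1) * (1 - (1 - r) * edgeProb p r (k + 1)) := by
  set q : ℝ := edgeProb p r (k + 1) with hq
  have hq' : (lastProb (rowLaw p r (k + 1)) : ℝ) = q := rfl
  have h1 : edgeProb p r (k + 2) = rowE p r (k + 1) fun x =>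
      q + (-((1 - r) * q)) * (if x (Fin.last k) = true then 1 else 0) := by
    rw [edgeProb, coe_lastProb, rowE_succ]
    congr 1
    funext x
    simp only [Fin.snoc_last, condProb]
    by_cases hx : x (Fin.last k) = true
    · simp [hx, hq']
      ring
    · simp [hx, hq']
  rw [h1, rowE_add, rowE_const_mul, rowE_const, ← coe_lastProb, hq']
  ring

theorem edgeProb_nonneg (k : ℕ) : 0 ≤ edgeProb p r k := by
  cases k with
  | zero => exact p.2.1
  | succ k => exact (lastProb (rowLaw p r (k + 1))).2.1

theorem edgeProb_le_one (k : ℕ) : edgeProb p r k ≤ 1 := by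
  cases k with
  | zero => exact p.2.2
  | succ k => exact (lastProb (rowLaw p r (k + 1))).2.2

theorem edgeProb_succ_le (k : ℕ) : edgeProb p r (k + 1) ≤ edgeProb p r k := by
  cases k with
  | zero => rw [edgeProb_one]; rfl
  | succ k =>
    rw [edgeProb_add_two]
    have h0 := edgeProb_nonneg p r (k + 1)
    have hr : 0 ≤ 1 - (r : ℝ) := sub_nonneg.2 r.2.2
    nlinarith [mul_nonneg hr (mul_nonneg h0 h0)]

theorem edgeProb_antitone : Antitone (edgeProb p r) :=
  antitone_nat_of_succ_le (edgeProb_succ_le p r)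

/-- Edges repel: after an edge the bias is multiplied by `r ≤ 1`. This uniform bound over all pasts
substitutes for independence within a row. -/
theorem condProb_le (k : ℕ) (x : Fin k → Bool) : (condProb p r k x : ℝ) ≤ edgeProb p r k := by
  cases k with
  | zero => rfl
  | succ k =>
    simp only [condProb, edgeProb]
    split_ifs
    · have h0 := (lastProb (rowLaw p r (k + 1))).2.1
      have h1 := r.2.2
      push_cast
      nlinarith
    · rfl

/-- The moment generating function of the number of edges from a vertex to its predecessors. -/
theorem rowE_prod_le {a : ℝ} (ha : 1 ≤ a) (k : ℕ) :
    rowE p r k (fun x => ∏ j, if x j = true then a else 1)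
      ≤ ∏ j ∈ Finset.range k, (1 + edgeProb p r j * (a - 1)) := by
  induction k with
  | zero => rw [rowE_zero]; simp
  | succ k ih =>
    rw [rowE_succ, Finset.prod_range_succ]
    have hb := edgeProb_nonneg p r k
    refine le_trans (rowE_mono p r (g := fun x => (∏ j, if x j = true then a else 1)
      * (1 + edgeProb p r k * (a - 1))) fun x => ?_) ?_
    · simp only [Fin.prod_univ_castSucc, Fin.snoc_castSucc, Fin.snoc_last]
      have hP : 0 ≤ ∏ j, (if x j = true then a else 1) :=
        Finset.prod_nonneg fun j _ => by split_ifs <;> linarith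
      have hc := condProb_le p r k x
      have : (condProb p r k x : ℝ) * (a - 1) ≤ edgeProb p r k * (a - 1) :=
        mul_le_mul_of_nonneg_right hc (by linarith)
      simp only [Bool.false_eq_true, if_false, if_true]
      nlinarith [mul_le_mul_of_nonneg_left this hP]
    · rw [rowE_mul_const]
      exact mul_le_mul_of_nonneg_right ih (by nlinarith)

/-- The probability that a vertex has no edges to a set `S` of its predecessors. -/
theorem le_rowE_forall_false (k : ℕ) (S : Finset (Fin k)) :
    ∏ j ∈ Finset.range S.card, (1 - edgeProb p r j)
      ≤ rowE p r k (fun x => if ∀ j ∈ S, x j = false then 1 else 0) := by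
  induction k with
  | zero =>
    have : S = ∅ := Finset.eq_empty_of_isEmpty S
    subst this
    rw [rowE_zero]; simp
  | succ k ih =>
    classical
    set T : Finset (Fin k) := Finset.univ.filter fun j => j.castSucc ∈ S with hT
    have hall : ∀ (x : Fin k → Bool) (b : Bool),
        (∀ j ∈ S, (Fin.snoc x b : Fin (k + 1) → Bool) j = false) ↔
          (∀ j ∈ T, x j = false) ∧ (Fin.last k ∈ S → b = false) := by
      intro x b
      constructor
      · intro h
        refine ⟨fun j hj => ?_, fun hl => ?_⟩
        · have := h j.castSucc (Finset.mem_filter.1 hj).2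
          rwa [Fin.snoc_castSucc] at this
        · have := h _ hl
          rwa [Fin.snoc_last] at this
      · rintro ⟨h1, h2⟩ j hj
        induction j using Fin.lastCases with
        | last => rw [Fin.snoc_last]; exact h2 hj
        | cast j => rw [Fin.snoc_castSucc]; exact h1 j (by simp [hT, hj])
    rw [rowE_succ]
    simp only [hall]
    have hmap : T.map Fin.castSuccEmb = S.erase (Fin.last k) := by
      ext j
      induction j using Fin.lastCases with
      | last => simp [Fin.castSucc_ne_last]
      | cast j => simp [hT, Fin.castSucc_ne_last]
    have hTc : T.card = (S.erase (Fin.last k)).card := by rw [← hmap, Finset.card_map]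
    by_cases hl : Fin.last k ∈ S
    · have hc : S.card = T.card + 1 := by
        rw [hTc, Finset.card_erase_add_one hl]
      have hle : T.card ≤ k := by simpa using Finset.card_le_univ T
      rw [hc, Finset.prod_range_succ]
      -- The factor gained has index `k`, the product asks for index `T.card ≤ k`. As the biases
      -- decrease, the initial segment is the worst position for `S`.
      have hb := edgeProb_antitone p r hle
      have h1 := edgeProb_le_one p r T.card
      refine (mul_le_mul_of_nonneg_right (ih T) (by linarith)).trans ?_
      rw [← rowE_mul_const]
      refine rowE_mono p r fun x => ?_
      have hcp := condProb_le p r k x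
      by_cases hx : ∀ j ∈ T, x j = false
      · rw [if_pos hx, if_pos ⟨hx, fun _ => trivial⟩, if_neg fun h => Bool.noConfusion (h.2 hl)]
        linarith
      · simp [hx]
    · have hc : S.card = T.card := by rw [hTc, Finset.erase_eq_of_notMem hl]
      rw [hc]
      refine (ih T).trans (rowE_mono p r fun x => ?_)
      by_cases hx : ∀ j ∈ T, x j = false
      · rw [if_pos hx, if_pos ⟨hx, fun h => absurd h hl⟩, if_pos ⟨hx, fun h => absurd h hl⟩]
        linarith
      · rw [if_neg hx, if_neg fun h => hx h.1, if_neg fun h => hx h.1]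
        simp

/-! ### Expectations over the whole graph -/

theorem graphE_zero (F : Sample 0 → ℝ) : graphE p r 0 F = F fun i => i.elim0 := by
  unfold graphE
  rw [Fintype.sum_subsingleton _ fun i : Fin 0 => i.elim0]
  simp

/-- Extends a sample by the edges from a new last vertex. -/
def extend {n : ℕ} (ω : Sample n) (x : Fin n → Bool) : Sample (n + 1) :=
  Fin.snoc (α := fun i : Fin (n + 1) => Fin (i : ℕ) → Bool) ω x

theorem extend_castSucc {n : ℕ} (ω : Sample n) (x : Fin n → Bool) (i : Fin n) :
    extend ω x i.castSucc = ω i :=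
  Fin.snoc_castSucc (α := fun i : Fin (n + 1) => Fin (i : ℕ) → Bool) _ _ _

theorem extend_last {n : ℕ} (ω : Sample n) (x : Fin n → Bool) :
    extend ω x (Fin.last n) = x :=
  Fin.snoc_last (α := fun i : Fin (n + 1) => Fin (i : ℕ) → Bool) _ _

/-- Independence of the rows lets the last vertex be exposed after all the others, enabling
induction on `n`. -/
theorem graphE_succ (n : ℕ) (F : Sample (n + 1) → ℝ) :
    graphE p r (n + 1) F = graphE p r n fun ω => rowE p r n fun x => F (extend ω x) := by
  unfold graphE rowE
  rw [← (Fin.snocEquiv fun i : Fin (n + 1) => (Fin (i : ℕ) → Bool)).sum_comp,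
    Fintype.sum_prod_type_right]
  refine Finset.sum_congr rfl fun ω _ => ?_
  rw [Finset.mul_sum]
  refine Finset.sum_congr rfl fun x _ => ?_
  have h : (Fin.snocEquiv fun i : Fin (n + 1) => (Fin (i : ℕ) → Bool)) (x, ω) = extend ω x := rfl
  rw [h, Fin.prod_univ_castSucc, extend_last, mul_assoc]
  simp only [extend_castSucc]
  rfl

theorem graphE_mono {n : ℕ} {F H : Sample n → ℝ} (h : ∀ ω, F ω ≤ H ω) :
    graphE p r n F ≤ graphE p r n H :=
  Finset.sum_le_sum fun ω _ => mul_le_mul_of_nonneg_left (h ω)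
    (Finset.prod_nonneg fun _ _ => ENNReal.toReal_nonneg)

theorem graphE_mul_const {n : ℕ} (c : ℝ) (F : Sample n → ℝ) :
    graphE p r n (fun ω => F ω * c) = graphE p r n F * c := by
  unfold graphE
  rw [Finset.sum_mul]
  exact Finset.sum_congr rfl fun ω _ => by ring

instance (n : ℕ) : IsProbabilityMeasure (graphMeasure p r n) := by
  unfold graphMeasure; infer_instance

theorem graphMeasure_real_eq (n : ℕ) (s : Set (Sample n)) [DecidablePred (· ∈ s)] :
    (graphMeasure p r n).real s = graphE p r n fun ω => if ω ∈ s then 1 else 0 := by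
  classical
  have h1 : s = ((Finset.univ.filter fun ω => ω ∈ s : Finset (Sample n)) : Set (Sample n)) := by
    ext; simp
  conv_lhs => rw [h1]
  rw [← sum_measureReal_singleton, Finset.sum_filter]
  unfold graphE
  refine Finset.sum_congr rfl fun ω _ => ?_
  by_cases hω : ω ∈ s
  · simp only [hω, if_true]
    rw [mul_one, Measure.real, graphMeasure, Measure.pi_singleton, ENNReal.toReal_prod]
    refine Finset.prod_congr rfl fun i _ => ?_
    rw [PMF.toMeasure_apply_singleton _ _ (measurableSet_singleton _)]
  · simp [hω]

open Classical in
/-- An event holds with high probability if its complement has probability tending to zero. -/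
theorem WHP.of_graphE_le {P : ∀ n : ℕ, SimpleGraph (Fin n) → Prop} {δ : ℕ → ℝ}
    (hδ : Tendsto δ atTop (𝓝 0))
    (h : ∀ᶠ n in atTop, graphE p r n (fun ω => if P n (graph ω) then 0 else 1) ≤ δ n) :
    WHP p r P := by
  have hreal : Tendsto (fun n => (graphMeasure p r n).real {ω | P n (graph ω)}) atTop (𝓝 1) := by
    have hlow : Tendsto (fun n => 1 - δ n) atTop (𝓝 1) := by simpa using hδ.const_sub 1
    refine tendsto_of_tendsto_of_tendsto_of_le_of_le' hlow tendsto_const_nhds ?_ ?_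
    · filter_upwards [h] with n hn
      have h2 := measureReal_compl (μ := graphMeasure p r n) (s := {ω | P n (graph ω)})
        (Set.toFinite _).measurableSet
      rw [graphMeasure_real_eq] at h2
      have h3 : (fun ω : Sample n => if ω ∈ {ω | P n (graph ω)}ᶜ then (1 : ℝ) else 0)
          = fun ω => if P n (graph ω) then 0 else 1 := by
        funext ω
        by_cases hω : P n (graph ω) <;> simp [hω]
      rw [h3, probReal_univ] at h2
      linarith
    · exact Eventually.of_forall fun n => measureReal_le_one
  unfold WHP
  rw [← ENNReal.ofReal_one]
  refine (ENNReal.tendsto_ofReal hreal).congr fun n => ?_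
  exact ofReal_measureReal

/-! ### Decay of the edge probabilities -/

/-- With `x = γ * q`, the induction step reduces to `(1 + x) * (1 - x) ≤ 1`; heuristically, `1 / q`
grows by at least `γ` per step. -/
theorem decay_mul_edgeProb_le (k : ℕ) :
    (1 - (r : ℝ)) * edgeProb p r (k + 1) * (k + 1) ≤ 1 := by
  have hγ : 0 ≤ 1 - (r : ℝ) := sub_nonneg.2 r.2.2
  have hγ1 : 1 - (r : ℝ) ≤ 1 := by linarith [r.2.1]
  induction k with
  | zero =>
    have h0 := edgeProb_nonneg p r (0 + 1)
    have h1 := edgeProb_le_one p r (0 + 1)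
    simp only [Nat.cast_zero, zero_add, mul_one] at *
    nlinarith
  | succ k ih =>
    rw [edgeProb_add_two]
    have h0 := edgeProb_nonneg p r (k + 1)
    have h1 := edgeProb_le_one p r (k + 1)
    set x : ℝ := (1 - (r : ℝ)) * edgeProb p r (k + 1) with hx
    have hx0 : 0 ≤ x := mul_nonneg hγ h0
    have hx1 : x ≤ 1 := mul_le_one₀ hγ1 h0 h1
    have e : (1 - (r : ℝ)) * (edgeProb p r (k + 1) * (1 - x)) * (((k + 1 : ℕ) : ℝ) + 1)
        = (x * (k + 1) + x) * (1 - x) := by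
      push_cast; rw [hx]; ring
    rw [e]
    calc (x * (k + 1) + x) * (1 - x) ≤ (1 + x) * (1 - x) :=
          mul_le_mul_of_nonneg_right (by linarith) (by linarith)
      _ ≤ 1 := by nlinarith

theorem sum_edgeProb_le (hr1 : r < 1) (k : ℕ) :
    ∑ j ∈ Finset.range k, edgeProb p r j ≤ 1 + (1 + Real.log k) / (1 - r) := by
  have hγ : 0 < 1 - (r : ℝ) := sub_pos.2 hr1
  cases k with
  | zero => simp; positivity
  | succ k =>
    rw [Finset.sum_range_succ', add_comm]
    refine add_le_add (edgeProb_le_one p r 0) ?_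
    have h1 : ∀ j ∈ Finset.range k, edgeProb p r (j + 1) ≤ ((j + 1 : ℕ) : ℝ)⁻¹ / (1 - r) := by
      intro j _
      have := decay_mul_edgeProb_le p r j
      rw [le_div_iff₀ hγ, inv_eq_one_div, le_div_iff₀ (by positivity)]
      push_cast
      linarith
    refine (Finset.sum_le_sum h1).trans ?_
    rw [← Finset.sum_div]
    refine div_le_div_of_nonneg_right ?_ hγ.le
    have h2 := harmonic_le_one_add_log k
    rw [harmonic] at h2
    push_cast at h2 ⊢
    refine h2.trans ?_
    have : Real.log k ≤ Real.log ((k : ℝ) + 1) := by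
      rcases Nat.eq_zero_or_pos k with rfl | hk
      · simp
      · exact Real.log_le_log (by exact_mod_cast hk) (by linarith)
    linarith

/-- The recursion reads `γ * q² = q - q'` with `q'` the next value, so the sum telescopes. -/
theorem sum_edgeProb_sq_le (hr1 : r < 1) (k : ℕ) :
    ∑ j ∈ Finset.range k, edgeProb p r j ^ 2 ≤ 1 + 1 / (1 - (r : ℝ)) := by
  have hγ : 0 < 1 - (r : ℝ) := sub_pos.2 hr1
  have htel : ∀ m : ℕ, (1 - (r : ℝ)) * ∑ j ∈ Finset.range m, edgeProb p r (j + 1) ^ 2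
      = edgeProb p r 1 - edgeProb p r (m + 1) := by
    intro m
    induction m with
    | zero => simp
    | succ m ih =>
      rw [Finset.sum_range_succ, mul_add, ih, edgeProb_add_two]
      ring
  cases k with
  | zero => simp; positivity
  | succ k =>
    rw [Finset.sum_range_succ', add_comm]
    have h0 := edgeProb_nonneg p r 0
    have h1 := edgeProb_le_one p r 0
    refine add_le_add (pow_le_one₀ h0 h1) ?_
    rw [le_div_iff₀ hγ, mul_comm, htel]
    linarith [edgeProb_le_one p r 1, edgeProb_nonneg p r (k + 1)]

/-- The product of the conditional probabilities of non-edges decays at most polynomially. -/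
theorem exists_mul_rpow_le_prod (hp1 : p < 1) (hr1 : r < 1) : ∃ c : ℝ, 0 < c ∧ ∀ k : ℕ, 0 < k →
    c * (k : ℝ) ^ (-(1 / (1 - (r : ℝ)))) ≤ ∏ j ∈ Finset.range k, (1 - edgeProb p r j) := by
  have hγ : 0 < 1 - (r : ℝ) := sub_pos.2 hr1
  have hq : 0 < 1 - (p : ℝ) := sub_pos.2 hp1
  set A : ℝ := 1 + 1 / (1 - (r : ℝ)) with hA
  -- The first `A` is the non-logarithmic part of the bound on `∑ q`; `A / (1 - p)` absorbs the
  -- quadratic error through `∑ q² ≤ A`.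
  refine ⟨Real.exp (-(A + A / (1 - p))), Real.exp_pos _, fun k hk => ?_⟩
  have hterm : ∀ j, Real.exp (-(edgeProb p r j + edgeProb p r j ^ 2 / (1 - p)))
      ≤ 1 - edgeProb p r j := by
    intro j
    have hb : edgeProb p r j ≤ p := edgeProb_antitone p r (Nat.zero_le j)
    set b := edgeProb p r j
    have hb0 : 0 ≤ b := edgeProb_nonneg p r j
    have h1b : 0 < 1 - b := by linarith
    rw [← Real.le_log_iff_exp_le h1b]
    have h1 := Real.one_sub_inv_le_log_of_pos h1b
    have h2 : 1 - (1 - b)⁻¹ = -(b + b ^ 2 / (1 - b)) := by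
      field_simp
      ring
    have h3 : b ^ 2 / (1 - b) ≤ b ^ 2 / (1 - p) :=
      div_le_div_of_nonneg_left (sq_nonneg b) hq (by linarith)
    linarith
  calc Real.exp (-(A + A / (1 - p))) * (k : ℝ) ^ (-(1 / (1 - (r : ℝ))))
      = Real.exp (-(1 + (1 + Real.log k) / (1 - r) + A / (1 - p))) := by
        rw [Real.rpow_def_of_pos (by exact_mod_cast hk), ← Real.exp_add]
        congr 1
        rw [hA]
        ring
    _ ≤ Real.exp (∑ j ∈ Finset.range k,
          -(edgeProb p r j + edgeProb p r j ^ 2 / (1 - p))) := by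
        rw [Real.exp_le_exp, Finset.sum_neg_distrib, Finset.sum_add_distrib, ← Finset.sum_div]
        have h1 := sum_edgeProb_le p r hr1 k
        have h2 := div_le_div_of_nonneg_right (sum_edgeProb_sq_le p r hr1 k) hq.le
        linarith
    _ ≤ _ := by
        rw [Real.exp_sum]
        exact Finset.prod_le_prod (fun _ _ => (Real.exp_pos _).le) fun j _ => hterm j

theorem prod_one_sub_edgeProb_antitone :
    Antitone fun k => ∏ j ∈ Finset.range k, (1 - edgeProb p r j) := by
  refine antitone_nat_of_succ_le fun k => ?_
  rw [Finset.prod_range_succ]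
  exact mul_le_of_le_one_right
    (Finset.prod_nonneg fun j _ => sub_nonneg.2 (edgeProb_le_one p r j))
    (by linarith [edgeProb_nonneg p r k])

/-! ### The in-order greedy process -/

section Greedy

theorem extend_castSucc_apply {n : ℕ} (ω : Sample n) (x : Fin n → Bool) (i : Fin n)
    (j : Fin (i : ℕ)) : extend ω x i.castSucc j = ω i j :=
  congrFun (extend_castSucc ω x i) j

theorem extend_last_apply {n : ℕ} (ω : Sample n) (x : Fin n → Bool) (j : Fin n) :
    extend ω x (Fin.last n) j = x j :=
  congrFun (extend_last ω x) j

theorem graph_extend_adj_castSucc {n : ℕ} (ω : Sample n) (x : Fin n → Bool) (u v : Fin n) :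
    (graph (extend ω x)).Adj u.castSucc v.castSucc ↔ (graph ω).Adj u v := by
  constructor
  · rintro (⟨h, h'⟩ | ⟨h, h'⟩)
    · exact Or.inl ⟨h, (extend_castSucc_apply ω x v ⟨u, h⟩).symm.trans h'⟩
    · exact Or.inr ⟨h, (extend_castSucc_apply ω x u ⟨v, h⟩).symm.trans h'⟩
  · rintro (⟨h, h'⟩ | ⟨h, h'⟩)
    · exact Or.inl ⟨h, (extend_castSucc_apply ω x v ⟨u, h⟩).trans h'⟩
    · exact Or.inr ⟨h, (extend_castSucc_apply ω x u ⟨v, h⟩).trans h'⟩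

theorem graph_extend_adj_last {n : ℕ} (ω : Sample n) (x : Fin n → Bool) (u : Fin n) :
    (graph (extend ω x)).Adj u.castSucc (Fin.last n) ↔ x u = true := by
  constructor
  · rintro (⟨h, h'⟩ | ⟨h, h'⟩)
    · exact (extend_last_apply ω x u).symm.trans h'
    · exact absurd h (by simp)
  · intro h
    exact Or.inl ⟨u.2, (extend_last_apply ω x u).trans h⟩

-- Decisions on earlier vertices do not see the new row, so the process is Markovian in the exposure
-- order.
open Classical in
theorem card_inOrderGreedy_extend {n : ℕ} (ω : Sample n) (x : Fin n → Bool) :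
    (inOrderGreedy (graph (extend ω x))).card = (inOrderGreedy (graph ω)).card
      + if ∀ u ∈ inOrderGreedy (graph ω), x u = false then 1 else 0 := by
  have hfold : ∀ (l : List (Fin n)) (S : Finset (Fin n)),
      (l.map Fin.castSucc).foldl (fun S v => if ∀ u ∈ S, ¬ (graph (extend ω x)).Adj u v
        then insert v S else S) (S.map Fin.castSuccEmb)
      = (l.foldl (fun S v => if ∀ u ∈ S, ¬ (graph ω).Adj u v then insert v S else S) S).map
        Fin.castSuccEmb := by
    intro l
    induction l with
    | nil => intro S; rfl
    | cons v l ih =>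
      intro S
      rw [List.map_cons, List.foldl_cons, List.foldl_cons, ← ih]
      congr 1
      have : (∀ u ∈ S.map Fin.castSuccEmb, ¬ (graph (extend ω x)).Adj u v.castSucc)
          ↔ ∀ u ∈ S, ¬ (graph ω).Adj u v := by
        simp [graph_extend_adj_castSucc]
      by_cases h : ∀ u ∈ S, ¬ (graph ω).Adj u v
      · rw [if_pos h, if_pos (this.2 h), Finset.map_insert]
        rfl
      · rw [if_neg h, if_neg fun h' => h (this.1 h')]
  have hS : inOrderGreedy (graph (extend ω x)) =
      if ∀ u ∈ (inOrderGreedy (graph ω)).map Fin.castSuccEmb,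
          ¬ (graph (extend ω x)).Adj u (Fin.last n)
        then insert (Fin.last n) ((inOrderGreedy (graph ω)).map Fin.castSuccEmb)
        else (inOrderGreedy (graph ω)).map Fin.castSuccEmb := by
    unfold inOrderGreedy
    rw [List.finRange_succ_last, List.foldl_append, ← hfold, Finset.map_empty]
    rfl
  have hiff : (∀ u ∈ (inOrderGreedy (graph ω)).map Fin.castSuccEmb,
      ¬ (graph (extend ω x)).Adj u (Fin.last n))
      ↔ ∀ u ∈ inOrderGreedy (graph ω), x u = false := by
    simp [graph_extend_adj_last]
  rw [hS]
  by_cases h : ∀ u ∈ inOrderGreedy (graph ω), x u = false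
  · rw [if_pos (hiff.2 h), if_pos h, Finset.card_insert_of_notMem, Finset.card_map]
    simp [Fin.castSucc_ne_last]
  · rw [if_neg fun h' => h (hiff.1 h'), if_neg h, Finset.card_map, add_zero]

/-- The potential halves when a vertex is accepted, which below size `M` has probability at least
`δ`, so its mean shrinks by a factor `1 - δ / 2`. It vanishes from size `M` on, and sizes never
decrease. -/
theorem graphE_greedy_potential_le {M : ℕ} {δ : ℝ} (hδ1 : δ ≤ 1)
    (hδ : ∀ k < M, δ ≤ ∏ j ∈ Finset.range k, (1 - edgeProb p r j)) (n : ℕ) :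
    graphE p r n (fun ω => if (inOrderGreedy (graph ω)).card < M
      then (1 / 2 : ℝ) ^ (inOrderGreedy (graph ω)).card else 0) ≤ (1 - δ / 2) ^ n := by
  classical
  induction n with
  | zero =>
    rw [graphE_zero, pow_zero]
    split_ifs
    · exact pow_le_one₀ (by norm_num) (by norm_num)
    · norm_num
  | succ n ih =>
    rw [graphE_succ, pow_succ]
    refine le_trans ?_ (mul_le_mul_of_nonneg_right ih (by linarith))
    rw [← graphE_mul_const]
    refine graphE_mono p r fun ω => ?_
    set S := inOrderGreedy (graph ω) with hS
    by_cases hM : S.card < M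
    · rw [if_pos hM]
      have h1 : ∀ x : Fin n → Bool,
          (if (inOrderGreedy (graph (extend ω x))).card < M
            then (1 / 2 : ℝ) ^ (inOrderGreedy (graph (extend ω x))).card else 0)
          ≤ (1 / 2) ^ S.card
            + (-((1 / 2) ^ S.card / 2)) * (if ∀ u ∈ S, x u = false then 1 else 0) := by
        intro x
        have hpow : (0 : ℝ) < (1 / 2) ^ S.card := by positivity
        rw [card_inOrderGreedy_extend, ← hS]
        by_cases hx : ∀ u ∈ S, x u = false
        · rw [if_pos hx, if_pos hx, pow_succ]
          split_ifs <;> linarith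
        · rw [if_neg hx, if_neg hx, add_zero, if_pos hM]
          linarith
      refine (rowE_mono p r h1).trans ?_
      rw [rowE_add, rowE_const_mul, rowE_const]
      have h2 : δ ≤ rowE p r n fun x => if ∀ u ∈ S, x u = false then 1 else 0 := by
        refine (hδ _ hM).trans ((le_rowE_forall_false p r n S).trans_eq ?_)
        congr 1
      have hpow : (0 : ℝ) < (1 / 2) ^ S.card := by positivity
      nlinarith [mul_le_mul_of_nonneg_left h2 hpow.le]
    · rw [if_neg hM, zero_mul]
      refine le_trans (rowE_mono p r (g := fun _ => 0) fun x => ?_) (rowE_const p r n 0).le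
      rw [if_neg]
      rw [card_inOrderGreedy_extend, ← hS]
      omega

/-- The in-order greedy algorithm is unlikely to output a small set. -/
theorem graphE_card_inOrderGreedy_lt_le {M : ℕ} {δ : ℝ} (hδ1 : δ ≤ 1)
    (hδ : ∀ k < M, δ ≤ ∏ j ∈ Finset.range k, (1 - edgeProb p r j)) (n : ℕ) :
    graphE p r n (fun ω => if (inOrderGreedy (graph ω)).card < M then 1 else 0)
      ≤ Real.exp (M - n * (δ / 2)) := by
  have h1 : graphE p r n (fun ω => if (inOrderGreedy (graph ω)).card < M then 1 else 0)
      ≤ (1 - δ / 2) ^ n * 2 ^ M := by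
    refine le_trans ?_ (mul_le_mul_of_nonneg_right
      (graphE_greedy_potential_le p r hδ1 hδ n) (by positivity))
    rw [← graphE_mul_const]
    refine graphE_mono p r fun ω => ?_
    split_ifs with h
    · have : (2 : ℝ) ^ (inOrderGreedy (graph ω)).card ≤ 2 ^ M :=
        pow_le_pow_right₀ (by norm_num) h.le
      rw [one_div, inv_pow, ← div_eq_inv_mul, le_div_iff₀ (by positivity)]
      linarith
    · simp
  have h2 : (1 - δ / 2) ^ n ≤ Real.exp (-(n * (δ / 2))) := by
    rw [← mul_neg, Real.exp_nat_mul]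
    exact pow_le_pow_left₀ (by linarith) (by linarith [Real.add_one_le_exp (-(δ / 2))]) n
  have h3 : (2 : ℝ) ^ M ≤ Real.exp M := by
    rw [← Real.exp_one_pow]
    exact pow_le_pow_left₀ (by norm_num) (by linarith [Real.add_one_le_exp (1 : ℝ)]) M
  calc _ ≤ _ := h1
    _ ≤ Real.exp (-(n * (δ / 2))) * Real.exp M :=
        mul_le_mul h2 h3 (by positivity) (Real.exp_pos _).le
    _ = _ := by rw [← Real.exp_add]; congr 1; ring

end Greedy

/-! ### Concentration of the number of edges -/

section Edges

/-- The number of edges of the graph determined by a sample. -/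
noncomputable def edgeCount {n : ℕ} (ω : Sample n) : ℝ :=
  ∑ i : Fin n, ∑ j : Fin (i : ℕ), if ω i j = true then 1 else 0

theorem sum_dite_lt {n m : ℕ} (h : m ≤ n) (g : Fin m → ℝ) :
    ∑ u : Fin n, (if h : (u : ℕ) < m then g ⟨u, h⟩ else 0) = ∑ j, g j := by
  rw [Fin.sum_univ_eq_sum_range (fun i => if h : i < m then g ⟨i, h⟩ else 0) n]
  have : ∑ j, g j = ∑ j : Fin m, (fun i => if h : i < m then g ⟨i, h⟩ else 0) (j : ℕ) :=
    Finset.sum_congr rfl fun j _ => by simp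
  rw [this, Fin.sum_univ_eq_sum_range (fun i => if h : i < m then g ⟨i, h⟩ else 0) m]
  refine (Finset.sum_subset (Finset.range_mono h) fun i _ hi => ?_).symm
  exact dif_neg fun h' => hi (Finset.mem_range.2 h')

theorem adjPairs_graph {n : ℕ} (ω : Sample n) :
    adjPairs (graph ω) Finset.univ Finset.univ = 2 * edgeCount ω := by
  classical
  have hpt : ∀ u v : Fin n, (if (graph ω).Adj u v then (1 : ℝ) else 0)
      = (if h : (u : ℕ) < v then (if ω v ⟨u, h⟩ = true then 1 else 0) else 0)
        + (if h : (v : ℕ) < u then (if ω u ⟨v, h⟩ = true then 1 else 0) else 0) := by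
    intro u v
    rcases lt_trichotomy (u : ℕ) v with h | h | h
    · have : (graph ω).Adj u v ↔ ω v ⟨u, h⟩ = true := by
        refine ⟨?_, fun h' => Or.inl ⟨h, h'⟩⟩
        rintro (⟨_, h'⟩ | ⟨h2, _⟩)
        · exact h'
        · exact absurd h2 h.not_gt
      rw [dif_pos h, dif_neg h.not_gt, add_zero]
      simp only [this]
    · rw [dif_neg h.not_lt, dif_neg h.not_gt, Fin.ext h, if_neg (SimpleGraph.irrefl _), add_zero]
    · have : (graph ω).Adj u v ↔ ω u ⟨v, h⟩ = true := by
        refine ⟨?_, fun h' => Or.inr ⟨h, h'⟩⟩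
        rintro (⟨h2, _⟩ | ⟨_, h'⟩)
        · exact absurd h2 h.not_gt
        · exact h'
      rw [dif_neg h.not_gt, dif_pos h, zero_add]
      simp only [this]
  have hsum : ∑ v : Fin n, ∑ u : Fin n,
      (if h : (u : ℕ) < v then (if ω v ⟨u, h⟩ = true then (1 : ℝ) else 0) else 0)
      = edgeCount ω :=
    Finset.sum_congr rfl fun v _ => sum_dite_lt v.2.le fun j => if ω v j = true then 1 else 0
  unfold adjPairs
  calc _ = ∑ u : Fin n, ∑ v : Fin n,
        ((if h : (u : ℕ) < v then (if ω v ⟨u, h⟩ = true then (1 : ℝ) else 0) else 0)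
        + (if h : (v : ℕ) < u then (if ω u ⟨v, h⟩ = true then 1 else 0) else 0)) :=
        Finset.sum_congr rfl fun u _ => Finset.sum_congr rfl fun v _ => by
          rw [← hpt]
    _ = _ := by
        simp only [Finset.sum_add_distrib]
        rw [hsum, Finset.sum_comm, hsum]
        ring

theorem edgeCount_extend {n : ℕ} (ω : Sample n) (x : Fin n → Bool) :
    edgeCount (extend ω x) = edgeCount ω + ∑ j, if x j = true then 1 else 0 := by
  unfold edgeCount
  rw [Fin.sum_univ_castSucc]
  congr 1
  · exact Finset.sum_congr rfl fun i _ => Finset.sum_congr rfl fun j _ => by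
      rw [← extend_castSucc_apply ω x i j]
  · exact Finset.sum_congr rfl fun j _ => by
      rw [← extend_last_apply ω x j]

/-- The row bounds on the generating function multiply by independence, and `1 + q * (exp t - 1) ≤
exp (q * (exp t - 1))` gives a Poisson-type bound. -/
theorem graphE_exp_edgeCount_le {t : ℝ} (ht : 0 ≤ t) (n : ℕ) :
    graphE p r n (fun ω => Real.exp (t * edgeCount ω))
      ≤ Real.exp ((Real.exp t - 1) * ∑ i ∈ Finset.range n, ∑ j ∈ Finset.range i,
          edgeProb p r j) := by
  have ha : 1 ≤ Real.exp t := Real.one_le_exp ht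
  induction n with
  | zero => rw [graphE_zero]; simp [edgeCount]
  | succ n ih =>
    rw [graphE_succ, Finset.sum_range_succ, mul_add, Real.exp_add]
    refine le_trans ?_ (mul_le_mul_of_nonneg_right ih (Real.exp_pos _).le)
    rw [← graphE_mul_const]
    refine graphE_mono p r fun ω => ?_
    have h1 : ∀ x : Fin n → Bool, Real.exp (t * edgeCount (extend ω x))
        = Real.exp (t * edgeCount ω) * ∏ j, if x j = true then Real.exp t else 1 := by
      intro x
      rw [edgeCount_extend, mul_add, Real.exp_add, Finset.mul_sum, Real.exp_sum]
      congr 1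
      refine Finset.prod_congr rfl fun j _ => ?_
      split_ifs <;> simp
    simp only [h1]
    rw [rowE_const_mul]
    refine mul_le_mul_of_nonneg_left ((rowE_prod_le p r ha n).trans ?_) (Real.exp_pos _).le
    rw [Finset.mul_sum, Real.exp_sum]
    refine Finset.prod_le_prod (fun j _ => ?_) fun j _ => ?_
    · have := edgeProb_nonneg p r j
      nlinarith
    · rw [mul_comm (Real.exp t - 1), add_comm]
      exact Real.add_one_le_exp _

theorem sum_sum_edgeProb_le (hr1 : r < 1) (n : ℕ) :
    ∑ i ∈ Finset.range n, ∑ j ∈ Finset.range i, edgeProb p r j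
      ≤ n * (1 + (1 + Real.log n) / (1 - r)) := by
  calc _ ≤ ∑ i ∈ Finset.range n, (1 + (1 + Real.log n) / (1 - (r : ℝ))) := by
        refine Finset.sum_le_sum fun i hi => ?_
        refine le_trans (Finset.sum_le_sum_of_subset_of_nonneg
          (Finset.range_mono (Finset.mem_range.1 hi).le) fun j _ _ => edgeProb_nonneg p r j) ?_
        exact sum_edgeProb_le p r hr1 n
    _ = _ := by rw [Finset.sum_const, Finset.card_range, nsmul_eq_mul]

open Classical in
/-- Chernoff bound for the number of edges. -/
theorem graphE_lt_edgeCount_le (hr1 : r < 1) {t : ℝ} (ht : 0 ≤ t) (m : ℝ) (n : ℕ) :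
    graphE p r n (fun ω => if m < edgeCount ω then 1 else 0)
      ≤ Real.exp ((Real.exp t - 1) * (n * (1 + (1 + Real.log n) / (1 - r))) - t * m) := by
  rw [sub_eq_add_neg, Real.exp_add]
  have h1 := graphE_exp_edgeCount_le p r ht n
  have h2 : Real.exp ((Real.exp t - 1) * ∑ i ∈ Finset.range n, ∑ j ∈ Finset.range i,
      edgeProb p r j) ≤ Real.exp ((Real.exp t - 1) * (n * (1 + (1 + Real.log n) / (1 - r)))) := by
    rw [Real.exp_le_exp]
    exact mul_le_mul_of_nonneg_left (sum_sum_edgeProb_le p r hr1 n)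
      (by linarith [Real.one_le_exp ht])
  refine le_trans ?_ (mul_le_mul_of_nonneg_right (h1.trans h2) (Real.exp_pos _).le)
  rw [← graphE_mul_const]
  refine graphE_mono p r fun ω => ?_
  rw [← Real.exp_add]
  split_ifs with h
  · rw [Real.one_le_exp_iff]
    nlinarith
  · exact (Real.exp_pos _).le

end Edges

/-! ### The two asymptotic bounds -/

/-- With high probability the in-order greedy algorithm outputs a set of order at least
`n ^ (γ / (1 + γ))`, where `γ = 1 - r`; hence its performance ratio is `O(n ^ (1 / (1 + γ)))`. -/
theorem whp_performanceRatio_inOrderGreedy_le (hp1 : p < 1) (hr1 : r < 1) :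
    ∃ C : ℝ, 0 < C ∧ WHP p r fun n G =>
      performanceRatio G (inOrderGreedy G) ≤ C * (n : ℝ) ^ (1 / (1 + (1 - (r : ℝ)))) := by
  classical
  obtain ⟨c, hc, hprod⟩ := exists_mul_rpow_le_prod p r hp1 hr1
  have hγ : 0 < 1 - (r : ℝ) := sub_pos.2 hr1
  set γ : ℝ := 1 - (r : ℝ) with hγdef
  -- This exponent solves `n * y ^ (-1 / γ) = y` with `y = n ^ θ`: the expected number of
  -- acceptances balances the target size.
  set θ : ℝ := γ / (1 + γ) with hθ
  have hθ0 : 0 < θ := by positivity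
  -- Small enough that `c * η ^ (-1 / γ) ≥ 4`, which will give `n * δ ≥ 4 * y`. Half of `η` is kept
  -- in reserve for the ceiling in `M`.
  set η : ℝ := min 1 ((c / 4) ^ γ) with hη
  have hη0 : 0 < η := lt_min one_pos (by positivity)
  have hη1 : η ≤ 1 := min_le_left _ _
  have hηc : 4 ≤ c * η ^ (-(1 / γ)) := by
    have h1 : ((c / 4) ^ γ) ^ (-(1 / γ)) ≤ η ^ (-(1 / γ)) :=
      Real.rpow_le_rpow_of_nonpos hη0 (min_le_right _ _) (by simp; positivity)
    rw [← Real.rpow_mul (by positivity), mul_neg, mul_one_div_cancel hγ.ne', Real.rpow_neg_one,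
      inv_div, div_le_iff₀ hc] at h1
    linarith
  have hytop : Tendsto (fun n : ℕ => (n : ℝ) ^ θ) atTop atTop :=
    (tendsto_rpow_atTop hθ0).comp tendsto_natCast_atTop_atTop
  refine ⟨(η / 2)⁻¹, by positivity, ?_⟩
  refine WHP.of_graphE_le p r (δ := fun n => Real.exp (-(n : ℝ) ^ θ))
    (Real.tendsto_exp_neg_atTop_nhds_zero.comp hytop) ?_
  filter_upwards [hytop.eventually_ge_atTop (η / 2)⁻¹, eventually_gt_atTop 0] with n hn hn0
  have hnpos : (0 : ℝ) < n := by exact_mod_cast hn0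
  set y : ℝ := (n : ℝ) ^ θ with hy
  have hy0 : 0 < y := by positivity
  have hκy : 1 ≤ η / 2 * y := by
    rwa [inv_le_iff_one_le_mul₀' (by positivity)] at hn
  set M : ℕ := ⌈η / 2 * y⌉₊ with hM
  have hM1 : η / 2 * y ≤ M := Nat.le_ceil _
  have hM2 : (M : ℝ) ≤ η * y := by
    have := Nat.ceil_lt_add_one (show 0 ≤ η / 2 * y by positivity)
    linarith
  have hM0 : 0 < M := Nat.ceil_pos.2 (by positivity)
  set δ : ℝ := c * (M : ℝ) ^ (-(1 / γ)) with hδ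
  have hδprod : ∀ k ≤ M, δ ≤ ∏ j ∈ Finset.range k, (1 - edgeProb p r j) := fun k hk =>
    (hprod M hM0).trans (prod_one_sub_edgeProb_antitone p r hk)
  have hδ1 : δ ≤ 1 := by simpa using hδprod 0 (Nat.zero_le _)
  have hbad := graphE_card_inOrderGreedy_lt_le p r hδ1 (fun k hk => hδprod k hk.le) n
  refine le_trans (graphE_mono p r fun ω => ?_) (hbad.trans ?_)
  · by_cases hlt : (inOrderGreedy (graph ω)).card < M
    · rw [if_pos hlt]
      split_ifs <;> norm_num
    · rw [if_neg hlt, if_pos]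
      have hN : η / 2 * y ≤ (inOrderGreedy (graph ω)).card :=
        hM1.trans (by exact_mod_cast not_lt.1 hlt)
      calc performanceRatio (graph ω) (inOrderGreedy (graph ω))
          ≤ n / (inOrderGreedy (graph ω)).card := by
            simpa using performanceRatio_le_card_div (graph ω) (inOrderGreedy (graph ω))
        _ ≤ n / (η / 2 * y) := div_le_div_of_nonneg_left hnpos.le (by positivity) hN
        _ = (η / 2)⁻¹ * (n : ℝ) ^ (1 / (1 + γ)) := by
            have h1 : (1 : ℝ) / (1 + γ) = 1 - θ := by rw [hθ]; field_simp; ring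
            rw [h1, Real.rpow_sub hnpos, Real.rpow_one, ← hy]
            field_simp
  -- The exponent is `M - n * δ / 2 ≤ y - 2 * y = -y`.
  · rw [Real.exp_le_exp]
    have h1 : (η * y) ^ (-(1 / γ)) ≤ (M : ℝ) ^ (-(1 / γ)) :=
      Real.rpow_le_rpow_of_nonpos (by exact_mod_cast hM0) hM2 (by simp; positivity)
    have h2 : n * y ^ (-(1 / γ)) = y := by
      rw [hy, ← Real.rpow_mul hnpos.le]
      nth_rewrite 1 [← Real.rpow_one (n : ℝ)]
      rw [← Real.rpow_add hnpos]
      congr 1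
      rw [hθ]
      field_simp
      ring
    have h3 : 4 * y ≤ n * δ := by
      calc 4 * y ≤ c * η ^ (-(1 / γ)) * y := mul_le_mul_of_nonneg_right hηc hy0.le
        _ = n * (c * (η * y) ^ (-(1 / γ))) := by
            rw [Real.mul_rpow hη0.le hy0.le]
            nth_rewrite 1 [← h2]
            ring
        _ ≤ n * δ := mul_le_mul_of_nonneg_left (mul_le_mul_of_nonneg_left h1 hc.le) hnpos.le
    have h4 : η * y ≤ y := mul_le_of_le_one_left hy0.le hη1
    linarith

/-- With high probability every output of the minimum-degree greedy algorithm has performance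
ratio at most `1 + (1 / γ + ε) * log n`, where `γ = 1 - r`. -/
theorem whp_performanceRatio_isMinDegreeOutput_le (hr1 : r < 1) {ε : ℝ} (hε : 0 < ε) :
    WHP p r fun n G => ∀ S : Finset (Fin n), IsMinDegreeOutput G S →
      performanceRatio G S ≤ 1 + (1 / (1 - (r : ℝ)) + ε) * Real.log n := by
  classical
  have hγ : 0 < 1 - (r : ℝ) := sub_pos.2 hr1
  set γ : ℝ := 1 - (r : ℝ) with hγdef
  -- The Chernoff tilt: `t ≤ 1` allows `exp t - 1 ≤ t + t²`, and `t / γ ≤ ε / 2` makes the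
  -- second-order loss cost only half of the slack `ε * log n`.
  set t : ℝ := min 1 (ε * γ / 2) with ht
  have ht0 : 0 < t := lt_min one_pos (by positivity)
  have ht1 : t ≤ 1 := min_le_left _ _
  have htε : t / γ ≤ ε / 2 := by
    rw [div_le_iff₀ hγ]
    linarith [min_le_right 1 (ε * γ / 2)]
  have hexp : Real.exp t - 1 ≤ t * (1 + t) := by
    have := (abs_le.1 (Real.abs_exp_sub_one_sub_id_le (x := t) (by rwa [abs_of_pos ht0]))).2
    linarith
  have hlog : Tendsto (fun n : ℕ => Real.log n) atTop atTop :=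
    Real.tendsto_log_atTop.comp tendsto_natCast_atTop_atTop
  have hδ : Tendsto (fun n : ℕ => Real.exp (-(t * n))) atTop (𝓝 0) :=
    Real.tendsto_exp_neg_atTop_nhds_zero.comp
      (tendsto_natCast_atTop_atTop.const_mul_atTop ht0)
  refine WHP.of_graphE_le p r hδ ?_
  -- Past this threshold the remaining `ε / 2 * log n` exceeds the constant term `2 * (1 + 1 / γ)`
  -- by at least `1`, so the exponent is at most `-t * n`.
  filter_upwards [hlog.eventually_ge_atTop ((2 * (1 + 1 / γ) + 1) / (ε / 2)),
    eventually_gt_atTop 0] with n hn hn0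
  have hnpos : (0 : ℝ) < n := by exact_mod_cast hn0
  set L : ℝ := Real.log n with hL
  rw [div_le_iff₀ (by positivity)] at hn
  have hL0 : 0 ≤ L := Real.log_natCast_nonneg n
  refine le_trans (graphE_mono p r fun ω => ?_)
    ((graphE_lt_edgeCount_le p r hr1 ht0.le (n * ((1 / γ + ε) * L)) n).trans ?_)
  · by_cases hlt : n * ((1 / γ + ε) * L) < edgeCount ω
    · rw [if_pos hlt]
      split_ifs <;> norm_num
    · rw [if_neg hlt, if_pos]
      intro S hS
      refine (performanceRatio_le_of_isMinDegreeOutput hS (by simpa using hn0)).trans ?_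
      rw [adjPairs_graph, Fintype.card_fin, mul_div_mul_left _ _ two_ne_zero]
      have : edgeCount ω / n ≤ (1 / γ + ε) * L := by
        rw [div_le_iff₀ hnpos]
        linarith
      linarith
  · rw [Real.exp_le_exp]
    have hB : 0 ≤ n * (1 + (1 + L) / γ) := by positivity
    have h1 : (Real.exp t - 1) * (n * (1 + (1 + L) / γ))
        ≤ t * (1 + t) * (n * (1 + (1 + L) / γ)) := mul_le_mul_of_nonneg_right hexp hB
    have h2 : t * (1 + t) * (n * (1 + (1 + L) / γ)) - t * (n * ((1 / γ + ε) * L))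
        = t * n * ((1 + t) * (1 + 1 / γ) + t / γ * L - ε * L) := by
      field_simp
      ring
    have h3 : (1 + t) * (1 + 1 / γ) ≤ 2 * (1 + 1 / γ) :=
      mul_le_mul_of_nonneg_right (by linarith) (by positivity)
    have h4 : t / γ * L ≤ ε / 2 * L := mul_le_mul_of_nonneg_right htε hL0
    have h5 : t * n * ((1 + t) * (1 + 1 / γ) + t / γ * L - ε * L) ≤ t * n * (-1) :=
      mul_le_mul_of_nonneg_left (by linarith) (by positivity)
    linarith

end MarkovGraph

theorem mainTheorem12 (p r : unitInterval) (hp : 0 < p) (hr0 : 0 < r) (hr1 : r < 1) :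
    (p < 1 → ∃ C : ℝ, 0 < C ∧
      MarkovGraph.WHP p r (fun n G =>
        MarkovGraph.performanceRatio G (MarkovGraph.inOrderGreedy G)
          ≤ C * (n : ℝ) ^ (1 / (1 + (1 - (r : ℝ)))))) ∧
    (∀ ε : ℝ, 0 < ε →
      MarkovGraph.WHP p r (fun n G =>
        ∀ S : Finset (Fin n), MarkovGraph.IsMinDegreeOutput G S →
          MarkovGraph.performanceRatio G S
            ≤ 1 + (1 / (1 - (r : ℝ)) + ε) * Real.log n)) :=
  ⟨fun hp1 => MarkovGraph.whp_performanceRatio_inOrderGreedy_le p r hp1 hr1,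
    fun _ hε => MarkovGraph.whp_performanceRatio_isMinDegreeOutput_le p r hr1 hε⟩
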